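/- Let $\mathcal H$ be a real Hilbert space. For a proper lower semicontinuous convex $f:\mathcal H\to\,]-\infty,+\infty]$ write $\operatorname{dom} f=\{x: f(x)<+\infty\}$, $f^*(u)=\sup_x(\langle u,x\rangle-f(x))$, $\partial f$ for the convex subdifferential, and $\nabla f$ for the Gâteaux gradient. The function $f$ is *Legendre* if it is * essentially smooth: $\operatorname{dom}\partial f=\operatorname{int}\operatorname{dom} f\neq\varnothing$, $f$ is Gâteaux differentiable on $\operatorname{int}\operatorname{dom} f$, and $\|\nabla f(x_k)\|\to+\infty$ for every sequence $(x_k)$ in $\operatorname{int}\operatorname{dom} f$ converging to a boundary point of $\operatorname{dom} f$; and * essentially strictly convex: $(\partial f)^{-1}$ is locally bounded on its domain, and $f$ is strictly convex on every convex subset of $\operatorname{dom}\partial f$. For such $f$ let $D_f(x,y)=f(x)-f(y)-\langle\nabla f(y),x-y\rangle$ if $y\in\operatorname{int}\operatorname{dom} f$, and $D_f(x,y)=+\infty$ otherwise. The map $\nabla f$ is defined on $\operatorname{int}\operatorname{dom} f$, and for $C\subseteq\mathcal H$ we write $\nabla f(C)=\{\nabla f(x): x\in C\cap\operatorname{int}\operatorname{dom}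 f\}$; likewise for $f^*$. For a finite nonempty set $K$ put $$\overleftarrow E_f(K)=\{p\in\operatorname{dom} f:\ D_f(p,q)=D_f(p,r)\ \text{for all } q,r\in K\}\qquad (K\subseteq \operatorname{int}\operatorname{dom} f),$$ $$\overrightarrow E_f(K)=\{p\in\operatorname{int}\operatorname{dom} f:\ D_f(q,p)=D_f(r,p)\ \text{for all } q,r\in K\}\qquad (K\subseteq \operatorname{dom} f),$$ and, with $\operatorname{aff}$ denoting the affine hull, define the backward pseudo-circumcenter, forward circumcenter and forward pseudo-circumcenter sets $$\overleftarrow{CC}{}^{ps}_f(K)=\operatorname{aff}(\nabla f(K))\cap\overleftarrow E_f(K),\qquad \overrightarrow{CC}_f(K)=\operatorname{aff}(K)\cap\overrightarrow E_f(K),\qquad \overrightarrow{CC}{}^{ps}_f(K)=\nabla f^*(\operatorname{aff} K)\cap\overrightarrow E_f(K).$$ **Theorem.** Let $f$ be Legendre and let $S\subseteq\operatorname{int}\operatorname{dom} f$ be finite and nonempty. Then 1. $\overleftarrow E_f(S)\cap\operatorname{int}\operatorname{dom} f=\nabla f^*\big(\overrightarrow E_{f^*}(\nabla f(S))\big)$.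 2. $\overrightarrow E_f(S)=\nabla f^*\big(\overleftarrow E_{f^*}(\nabla f(S))\cap\operatorname{int}\operatorname{dom} f^*\big)$. 3. $\overleftarrow{CC}{}^{ps}_f(S)\cap\operatorname{int}\operatorname{dom} f=\nabla f^*\big(\overrightarrow{CC}{}^{ps}_{f^*}(\nabla f(S))\big)$. 4. $\overrightarrow{CC}_f(S)=\operatorname{aff}(S)\cap\nabla f^*\big(\overleftarrow E_{f^*}(\nabla f(S))\cap\operatorname{int}\operatorname{dom} f^*\big)=\nabla f^*\big(\nabla f(\operatorname{aff} S)\cap\overleftarrow E_{f^*}(\nabla f(S))\big)$. -/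

import Mathlib

noncomputable section

namespace Bregman

variable {H : Type*} [NormedAddCommGroup H] [InnerProductSpace ℝ H]

/-- The (effective) domain `dom f = {x | f x < +∞}` of an extended-real-valued function. -/
def dom (f : H → EReal) : Set H := {x | f x < ⊤}

/-- The interior of the domain, `int dom f`. -/
def intDom (f : H → EReal) : Set H := interior (dom f)

/-- `Γ₀(H)`: proper closed (i.e. lower semicontinuous) convex functions `H → ]-∞, +∞]`.
The convexity inequality is only asked for weights in `]0, 1[`, where all the products and sums
below are the usual ones of `]-∞, +∞]`. -/
structure IsGammaZero (f : H → EReal) : Prop where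
  ne_bot : ∀ x, f x ≠ ⊥
  dom_nonempty : (dom f).Nonempty
  lowerSemicontinuous : LowerSemicontinuous f
  convex : ∀ x y : H, ∀ a b : ℝ, 0 < a → 0 < b → a + b = 1 →
    f (a • x + b • y) ≤ (a : EReal) * f x + (b : EReal) * f y

/-- The (Fenchel) conjugate `f*(u) = sup_x (⟨u, x⟩ - f x)`. -/
def conj (f : H → EReal) (u : H) : EReal := ⨆ x : H, ((inner ℝ u x : ℝ) : EReal) - f x

/-- The convex subdifferential `∂f(x) = {u | ∀ y, ⟨u, y - x⟩ + f x ≤ f y}`. -/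
def subdiff (f : H → EReal) (x : H) : Set H :=
  {u | ∀ y : H, ((inner ℝ u (y - x) : ℝ) : EReal) + f x ≤ f y}

/-- `dom ∂f`. -/
def domSubdiff (f : H → EReal) : Set H := {x | (subdiff f x).Nonempty}

/-- The inverse `(∂f)⁻¹` of the subdifferential as a set-valued operator. -/
def invSubdiff (f : H → EReal) (u : H) : Set H := {x | u ∈ subdiff f x}

/-- A set-valued operator `A` is locally bounded at `x` if it maps some closed ball around `x`
to a bounded set. -/
def LocallyBoundedAt (A : H → Set H) (x : H) : Prop :=
  ∃ δ : ℝ, 0 < δ ∧ Bornology.IsBounded (⋃ z ∈ Metric.closedBall x δ, A z)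

/-- `u` is the Gâteaux gradient of `f` at `x`: near `x` on each line through `x` (recall that this
is used for `x ∈ int dom f`) the function is real-valued, and its derivative at `x` in every
direction `h` is `⟨u, h⟩`. -/
def HasGateauxGradientAt (f : H → EReal) (u x : H) : Prop :=
  ∀ h : H, HasLineDerivAt ℝ (fun z => (f z).toReal) (inner ℝ u h) x h

/-- `f` is Gâteaux differentiable on `int dom f`. -/
def GateauxDifferentiableOnIntDom (f : H → EReal) : Prop :=
  ∀ x ∈ intDom f, ∃ u, HasGateauxGradientAt f u x

open Classical in
/-- The gradient `∇f`. It is meaningful on `int dom f` (for `f` Gâteaux differentiable there),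
and has the junk value `0` at points without a Gâteaux gradient. -/
def grad (f : H → EReal) (x : H) : H :=
  if h : ∃ u, HasGateauxGradientAt f u x then h.choose else 0

/-- The image `∇f(C)` of a set under the mapping `∇f : int dom f → H`. Points of `C` outside
`int dom f`, where `∇f` is not defined, do not contribute. -/
def gradImage (f : H → EReal) (C : Set H) : Set H := grad f '' (C ∩ intDom f)

/-- Essentially smooth functions. -/
structure IsEssentiallySmooth (f : H → EReal) : Prop where
  domSubdiff_eq : domSubdiff f = intDom f
  intDom_nonempty : (intDom f).Nonempty
  differentiable : GateauxDifferentiableOnIntDom f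
  tendsto_norm_grad : ∀ x : ℕ → H, (∀ k, x k ∈ intDom f) → ∀ z ∈ frontier (dom f),
    Filter.Tendsto x Filter.atTop (nhds z) →
      Filter.Tendsto (fun k => ‖grad f (x k)‖) Filter.atTop Filter.atTop

/-- Essentially strictly convex functions. -/
structure IsEssentiallyStrictlyConvex (f : H → EReal) : Prop where
  locallyBounded : ∀ u : H, (invSubdiff f u).Nonempty → LocallyBoundedAt (invSubdiff f) u
  strictConvex : ∀ C : Set H, C ⊆ domSubdiff f → Convex ℝ C →
    ∀ x ∈ C, ∀ y ∈ C, x ≠ y → ∀ a b : ℝ, 0 < a → 0 < b → a + b = 1 →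
      f (a • x + b • y) < (a : EReal) * f x + (b : EReal) * f y

/-- Legendre functions: members of `Γ₀(H)` that are essentially smooth and essentially
strictly convex. -/
structure IsLegendre (f : H → EReal) : Prop where
  gammaZero : IsGammaZero f
  smooth : IsEssentiallySmooth f
  strictlyConvex : IsEssentiallyStrictlyConvex f

open Classical in
/-- The Bregman distance: `D_f(x, y) = f x - f y - ⟨∇f(y), x - y⟩` if `y ∈ int dom f`, and `+∞`
otherwise. -/
def bregmanDist (f : H → EReal) (x y : H) : EReal :=
  if y ∈ intDom f then f x - f y - ((inner ℝ (grad f y) (x - y) : ℝ) : EReal) else ⊤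

/-- The backward equidistant set: the points `p ∈ dom f` for which `D_f(p, q)` is the same
for all `q ∈ K`. -/
def backwardE (f : H → EReal) (K : Set H) : Set H :=
  {p | p ∈ dom f ∧ ∀ q ∈ K, ∀ r ∈ K, bregmanDist f p q = bregmanDist f p r}

/-- The forward equidistant set: the points `p ∈ int dom f` for which `D_f(q, p)` is the same
for all `q ∈ K`. -/
def forwardE (f : H → EReal) (K : Set H) : Set H :=
  {p | p ∈ intDom f ∧ ∀ q ∈ K, ∀ r ∈ K, bregmanDist f q p = bregmanDist f r p}

/-- The backward Bregman pseudo-circumcenter operator `K ↦ aff (∇f(K)) ∩ backwardE f K`. -/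
def backwardPseudoCC (f : H → EReal) (K : Set H) : Set H :=
  (affineSpan ℝ (gradImage f K) : Set H) ∩ backwardE f K

/-- The forward Bregman circumcenter operator `K ↦ aff K ∩ forwardE f K`. -/
def forwardCC (f : H → EReal) (K : Set H) : Set H :=
  (affineSpan ℝ K : Set H) ∩ forwardE f K

/-- The forward Bregman pseudo-circumcenter operator `K ↦ ∇f*(aff K) ∩ forwardE f K`. -/
def forwardPseudoCC (f : H → EReal) (K : Set H) : Set H :=
  gradImage (conj f) (affineSpan ℝ K : Set H) ∩ forwardE f K

end Bregman

end

/-!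
The theorem rests on the fact that for a Legendre function `f` the gradient is a bijection from
`int dom f` onto `int dom f*` with inverse `∇f*`. Given this and the Fenchel–Young equality,
`D_f(x, y) = D_{f*}(∇f y, ∇f x)` for `x, y ∈ int dom f` (`IsLegendre.bregmanDist_eq`), so `∇f`
exchanges backward and forward equidistant sets; the statements on pseudo-circumcenters use
`f** = f` in addition.

The bijection has three ingredients.

* Local boundedness of `(∂f)⁻¹` forces linear growth of `f - ∇f(x)`, whence `∇f(x) ∈ int dom f*`
  (`IsGammaZero.mem_intDom_conj`). The argument uses proximal points (`IsGammaZero.exists_prox`),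
  which also give the Fenchel–Moreau theorem `f** = f` (`IsGammaZero.conj_conj`).
* For `u ∈ int dom f*` the sublevel sets of `f - u` are bounded by the Banach–Steinhaus theorem, so
  `f - u` has a minimizer `x` (`IsGammaZero.exists_invSubdiff`), i.e. `u ∈ ∂f(x)`. Essential
  smoothness then puts `x` in `int dom f` and gives `u = ∇f(x)`.
* Strict convexity makes the minimizer unique (`IsLegendre.subdiff_injective`), which implies that it
  is the Gâteaux gradient of `f*` at `u` (`IsGammaZero.hasGateauxGradientAt_conj`).

All minimizers come from the same compactness substitute: a decreasing sequence of nonempty closed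
bounded convex sets in a Hilbert space has a common point.
-/

namespace Bregman

variable {H : Type*} [NormedAddCommGroup H] [InnerProductSpace ℝ H] {f : H → EReal}

open Filter Topology

/-! ### Nested convex sets -/

/-- A decreasing sequence of nonempty closed bounded convex sets in a Hilbert space has a common
point. The elements of minimal norm form a Cauchy sequence by the parallelogram law, which
replaces weak compactness of the sets. -/
theorem nonempty_iInter_of_antitone_convex [CompleteSpace H] (C : ℕ → Set H) (hanti : Antitone C)
    (hne : ∀ n, (C n).Nonempty) (hcl : ∀ n, IsClosed (C n)) (hcv : ∀ n, Convex ℝ (C n))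
    (hb : Bornology.IsBounded (C 0)) : (⋂ n, C n).Nonempty := by
  have hmin : ∀ n, ∃ x ∈ C n, ∀ y ∈ C n, ‖x‖ ≤ ‖y‖ := by
    intro n
    obtain ⟨x, hx, hxe⟩ := exists_norm_eq_iInf_of_complete_convex (hne n) (hcl n).isComplete
      (hcv n) 0
    refine ⟨x, hx, fun y hy => ?_⟩
    simp only [zero_sub, norm_neg] at hxe
    rw [hxe]
    exact ciInf_le ⟨0, by rintro _ ⟨w, rfl⟩; exact norm_nonneg _⟩ (⟨y, hy⟩ : C n)
  choose x hxC hxmin using hmin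
  have hmono : Monotone fun n => ‖x n‖ ^ 2 := fun n m hnm =>
    pow_le_pow_left₀ (norm_nonneg _) (hxmin n _ (hanti hnm (hxC m))) 2
  obtain ⟨R, hR⟩ := hb.exists_norm_le
  have hbdd : BddAbove (Set.range fun n => ‖x n‖ ^ 2) :=
    ⟨R ^ 2, by
      rintro _ ⟨n, rfl⟩
      exact pow_le_pow_left₀ (norm_nonneg _) (hR _ (hanti (Nat.zero_le n) (hxC n))) 2⟩
  have hlim := tendsto_atTop_ciSup hmono hbdd
  have hdist : ∀ n m, n ≤ m → ‖x n - x m‖ ^ 2 ≤ 2 * (‖x m‖ ^ 2 - ‖x n‖ ^ 2) := by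
    intro n m hnm
    have hmid : (1 / 2 : ℝ) • x n + (1 / 2 : ℝ) • x m ∈ C n :=
      hcv n (hxC n) (hanti hnm (hxC m)) (by norm_num) (by norm_num) (by norm_num)
    have h1 := hxmin n _ hmid
    rw [← smul_add, norm_smul, Real.norm_of_nonneg (by norm_num)] at h1
    have h2 := parallelogram_law_with_norm ℝ (x n) (x m)
    have h3 := norm_nonneg (x n)
    nlinarith
  have hcau : CauchySeq x := by
    rw [Metric.cauchySeq_iff']
    intro ε hε
    have hc := hlim.cauchySeq
    rw [Metric.cauchySeq_iff'] at hc
    obtain ⟨N, hN⟩ := hc (ε ^ 2 / 2) (by positivity)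
    refine ⟨N, fun n hn => ?_⟩
    have h1 := hN n hn
    rw [Real.dist_eq] at h1
    have h2 := (abs_lt.1 h1).2
    have h3 := hdist N n hn
    rw [dist_comm, dist_eq_norm]
    refine lt_of_pow_lt_pow_left₀ 2 hε.le ?_
    linarith
  obtain ⟨l, hl⟩ := cauchySeq_tendsto_of_complete hcau
  refine ⟨l, Set.mem_iInter.2 fun n => (hcl n).mem_of_tendsto hl ?_⟩
  filter_upwards [eventually_ge_atTop n] with m hm using hanti hm (hxC m)

/-! ### Real-valued forms of the convex-analytic notions -/

theorem IsGammaZero.coe_toReal (hf : IsGammaZero f) {x : H} (hx : x ∈ dom f) :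
    ((f x).toReal : EReal) = f x :=
  EReal.coe_toReal (ne_of_lt hx) (hf.ne_bot x)

theorem mem_dom_of_le_coe {X : Type*} {f : X → EReal} {x : X} {k : ℝ} (h : f x ≤ (k : EReal)) : x ∈ dom f :=
  lt_of_le_of_lt h (EReal.coe_lt_top k)

theorem IsGammaZero.le_coe_iff (hf : IsGammaZero f) {x : H} {k : ℝ} :
    f x ≤ (k : EReal) ↔ x ∈ dom f ∧ (f x).toReal ≤ k := by
  constructor
  · intro h
    have hx := mem_dom_of_le_coe h
    refine ⟨hx, ?_⟩
    rwa [← hf.coe_toReal hx, EReal.coe_le_coe_iff] at h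
  · rintro ⟨hx, h⟩
    rwa [← hf.coe_toReal hx, EReal.coe_le_coe_iff]

theorem IsGammaZero.convexOn (hf : IsGammaZero f) : ConvexOn ℝ (dom f) fun x => (f x).toReal := by
  have key : ∀ x ∈ dom f, ∀ y ∈ dom f, ∀ a b : ℝ, 0 < a → 0 < b → a + b = 1 →
      f (a • x + b • y) ≤ ((a * (f x).toReal + b * (f y).toReal : ℝ) : EReal) := by
    intro x hx y hy a b ha hb hab
    have h := hf.convex x y a b ha hb hab
    rw [← hf.coe_toReal hx, ← hf.coe_toReal hy] at h
    exact_mod_cast h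
  have hc : Convex ℝ (dom f) := by
    rw [convex_iff_forall_pos]
    intro x hx y hy a b ha hb hab
    exact mem_dom_of_le_coe (key x hx y hy a b ha hb hab)
  refine convexOn_iff_forall_pos.2 ⟨hc, fun x hx y hy a b ha hb hab => ?_⟩
  exact (hf.le_coe_iff.1 (key x hx y hy a b ha hb hab)).2

theorem IsGammaZero.conj_le_coe_iff (hf : IsGammaZero f) {u : H} {k : ℝ} :
    conj f u ≤ (k : EReal) ↔ ∀ y ∈ dom f, inner ℝ u y - (f y).toReal ≤ k := by
  unfold conj
  rw [iSup_le_iff]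
  constructor
  · intro h y hy
    have := h y
    rw [← hf.coe_toReal hy] at this
    exact_mod_cast this
  · intro h y
    by_cases hy : y ∈ dom f
    · rw [← hf.coe_toReal hy]
      exact_mod_cast h y hy
    · have : f y = ⊤ := not_lt_top_iff.1 hy
      simp [this]

theorem IsGammaZero.conj_ne_bot (hf : IsGammaZero f) (u : H) : conj f u ≠ ⊥ := by
  obtain ⟨x, hx⟩ := hf.dom_nonempty
  have h : ((inner ℝ u x : ℝ) : EReal) - f x ≤ conj f u :=
    le_iSup (fun x : H => ((inner ℝ u x : ℝ) : EReal) - f x) x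
  rw [← hf.coe_toReal hx, ← EReal.coe_sub] at h
  exact fun hb => EReal.coe_ne_bot _ (le_bot_iff.1 (hb ▸ h))

theorem IsGammaZero.coe_toReal_conj (hf : IsGammaZero f) {u : H} (hu : u ∈ dom (conj f)) :
    ((conj f u).toReal : EReal) = conj f u :=
  EReal.coe_toReal (ne_of_lt hu) (hf.conj_ne_bot u)

/-- The Fenchel–Young inequality in real-valued form. -/
theorem IsGammaZero.inner_sub_le_conj (hf : IsGammaZero f) {u y : H} (hu : u ∈ dom (conj f))
    (hy : y ∈ dom f) : inner ℝ u y - (f y).toReal ≤ (conj f u).toReal :=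
  hf.conj_le_coe_iff.1 (hf.coe_toReal_conj hu).ge y hy

theorem IsGammaZero.mem_subdiff_iff (hf : IsGammaZero f) {u x : H} :
    u ∈ subdiff f x ↔
      x ∈ dom f ∧ ∀ y ∈ dom f, inner ℝ u (y - x) + (f x).toReal ≤ (f y).toReal := by
  constructor
  · intro h
    have hx : x ∈ dom f := by
      obtain ⟨y, hy⟩ := hf.dom_nonempty
      by_contra hx
      have hx' : f x = ⊤ := not_lt_top_iff.1 hx
      have := h y
      rw [hx', EReal.coe_add_top] at this
      exact absurd (lt_of_le_of_lt this hy) (lt_irrefl _)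
    refine ⟨hx, fun y hy => ?_⟩
    have := h y
    rw [← hf.coe_toReal hx, ← hf.coe_toReal hy] at this
    exact_mod_cast this
  · rintro ⟨hx, h⟩ y
    by_cases hy : y ∈ dom f
    · rw [← hf.coe_toReal hx, ← hf.coe_toReal hy]
      exact_mod_cast h y hy
    · have : f y = ⊤ := not_lt_top_iff.1 hy
      simp [this]

/-- Subgradients attain equality in the Fenchel–Young inequality. -/
theorem IsGammaZero.conj_eq_of_mem_subdiff (hf : IsGammaZero f) {u x : H}
    (h : u ∈ subdiff f x) : conj f u = ((inner ℝ u x - (f x).toReal : ℝ) : EReal) := by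
  obtain ⟨hx, h⟩ := hf.mem_subdiff_iff.1 h
  refine le_antisymm (hf.conj_le_coe_iff.2 fun y hy => ?_) ?_
  · have := h y hy
    rw [inner_sub_right] at this
    linarith
  · rw [EReal.coe_sub, hf.coe_toReal hx]
    exact le_iSup (fun x : H => ((inner ℝ u x : ℝ) : EReal) - f x) x

/-- A point where `f` lies below its affine minorant `⟨u, ·⟩ - f*(u)` has `u` as a subgradient. -/
theorem IsGammaZero.mem_subdiff_of_le (hf : IsGammaZero f) {u x : H} (hu : u ∈ dom (conj f))
    (h : f x ≤ ((inner ℝ u x - (conj f u).toReal : ℝ) : EReal)) : u ∈ subdiff f x := by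
  obtain ⟨hx, h⟩ := hf.le_coe_iff.1 h
  refine hf.mem_subdiff_iff.2 ⟨hx, fun y hy => ?_⟩
  have := hf.inner_sub_le_conj hu hy
  rw [inner_sub_right]
  linarith

/-! ### Existence of minimizers and proximal points -/

theorem IsGammaZero.isClosed_le (hf : IsGammaZero f) {r : H → ℝ} (hr : Continuous r) :
    IsClosed {y | f y ≤ (r y : EReal)} :=
  hf.lowerSemicontinuous.isClosed_epigraph.preimage
    (continuous_id.prodMk (continuous_coe_real_ereal.comp hr))

theorem IsGammaZero.convex_le (hf : IsGammaZero f) {r : H → ℝ} (hr : ConcaveOn ℝ Set.univ r) :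
    Convex ℝ {y | f y ≤ (r y : EReal)} := by
  have h := (hf.convexOn.sub (hr.subset (Set.subset_univ _) hf.convexOn.1)).convex_le 0
  convert h using 1
  ext y
  simp [hf.le_coe_iff]

/-- Let `r` be concave and continuous, with `{f ≤ r + 1}` bounded. If `f ≤ r + ε` has a solution in a
closed convex set `C` for every `ε > 0`, then so has `f ≤ r`. -/
theorem IsGammaZero.exists_le [CompleteSpace H] (hf : IsGammaZero f) {r : H → ℝ}
    (hrc : Continuous r) (hr : ConcaveOn ℝ Set.univ r) {C : Set H} (hC : IsClosed C)
    (hCc : Convex ℝ C) (hb : Bornology.IsBounded {y | f y ≤ ((r y + 1 : ℝ) : EReal)})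
    (hne : ∀ ε : ℝ, 0 < ε → ∃ y ∈ C, f y ≤ ((r y + ε : ℝ) : EReal)) :
    ∃ y ∈ C, f y ≤ (r y : EReal) := by
  obtain ⟨y, hy⟩ := nonempty_iInter_of_antitone_convex
    (fun n : ℕ => C ∩ {y | f y ≤ ((r y + 1 / ((n : ℝ) + 1) : ℝ) : EReal)})
    (fun n m hnm y hy => by
      have h : 1 / ((m : ℝ) + 1) ≤ 1 / ((n : ℝ) + 1) := Nat.one_div_le_one_div hnm
      obtain ⟨hyd, hy'⟩ := hf.le_coe_iff.1 hy.2
      exact ⟨hy.1, hf.le_coe_iff.2 ⟨hyd, by linarith⟩⟩)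
    (fun n => hne _ Nat.one_div_pos_of_nat)
    (fun n => hC.inter (hf.isClosed_le (hrc.add continuous_const)))
    (fun n => hCc.inter (hf.convex_le (hr.add_const _)))
    (hb.subset (by intro y hy; simpa using hy.2))
  rw [Set.mem_iInter] at hy
  have hyd : y ∈ dom f := mem_dom_of_le_coe (hy 0).2
  refine ⟨y, (hy 0).1, hf.le_coe_iff.2 ⟨hyd, ?_⟩⟩
  refine le_of_forall_pos_lt_add fun ε hε => ?_
  obtain ⟨n, hn⟩ := exists_nat_one_div_lt hε
  have := (hf.le_coe_iff.1 (hy n).2).2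
  linarith

theorem inner_add_sq_lower (u y a : H) {c : ℝ} :
    inner ℝ u y + c / 2 * ‖y - a‖ ^ 2 ≥ inner ℝ u a - ‖u‖ * ‖y - a‖ + c / 2 * ‖y - a‖ ^ 2 := by
  have h1 : inner ℝ u y = inner ℝ u a + inner ℝ u (y - a) := by rw [← inner_add_right]; simp
  have h2 := (abs_le.1 (abs_real_inner_le_norm u (y - a))).1
  linarith

/-- Every point `a` has a proximal point `z`, i.e. `a = z + c⁻¹ v` with `v ∈ ∂f(z)`. -/
theorem IsGammaZero.exists_prox [CompleteSpace H] (hf : IsGammaZero f) {u₀ x₀ : H}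
    (h₀ : u₀ ∈ subdiff f x₀) {c : ℝ} (hc : 0 < c) (a : H) :
    ∃ z, c • (a - z) ∈ subdiff f z := by
  obtain ⟨hx₀, h₀⟩ := hf.mem_subdiff_iff.1 h₀
  set q : H → ℝ := fun y => (f y).toReal + c / 2 * ‖y - a‖ ^ 2 with hq
  set k : ℝ := (f x₀).toReal - inner ℝ u₀ x₀ + inner ℝ u₀ a with hk
  have hlow : ∀ y ∈ dom f, k - ‖u₀‖ * ‖y - a‖ + c / 2 * ‖y - a‖ ^ 2 ≤ q y := by
    intro y hy
    have h1 := h₀ y hy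
    have h2 := inner_add_sq_lower u₀ y a (c := c)
    rw [inner_sub_right] at h1
    simp only [hq, hk]
    linarith
  have hbelow : BddBelow (q '' dom f) := by
    refine ⟨k - ‖u₀‖ ^ 2 / (2 * c), ?_⟩
    rintro _ ⟨y, hy, rfl⟩
    have h1 := hlow y hy
    have h2 : -‖u₀‖ * ‖y - a‖ + c / 2 * ‖y - a‖ ^ 2 + ‖u₀‖ ^ 2 / (2 * c)
        = (c * ‖y - a‖ - ‖u₀‖) ^ 2 / (2 * c) := by field_simp; ring
    have h3 : 0 ≤ (c * ‖y - a‖ - ‖u₀‖) ^ 2 / (2 * c) := by positivity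
    linarith
  set m := sInf (q '' dom f) with hm
  have hmle : ∀ y ∈ dom f, m ≤ q y := fun y hy => csInf_le hbelow ⟨y, hy, rfl⟩
  have hconc : ConcaveOn ℝ Set.univ fun y : H => m - c / 2 * ‖y - a‖ ^ 2 := by
    have h1 : ConvexOn ℝ Set.univ fun y : H => ‖y - a‖ ^ 2 := by
      have := (convexOn_univ_norm (E := H)).translate_right (-a)
      have h2 : ConvexOn ℝ Set.univ fun y : H => ‖y - a‖ := by
        simpa [Function.comp_def, sub_eq_neg_add] using this
      exact h2.pow (fun _ _ => norm_nonneg _) 2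
    have h2 := h1.smul (show 0 ≤ c / 2 by positivity)
    exact (concaveOn_const m convex_univ).sub h2
  obtain ⟨z, -, hz⟩ := hf.exists_le (r := fun y : H => m - c / 2 * ‖y - a‖ ^ 2) (by fun_prop) hconc
    isClosed_univ convex_univ (by
      rw [Metric.isBounded_iff_subset_closedBall a]
      set E := |m + 1 - k|
      refine ⟨max 1 (2 * (E + ‖u₀‖) / c), fun y hy => ?_⟩
      obtain ⟨hyd, hy⟩ := hf.le_coe_iff.1 hy
      have h1 := hlow y hyd
      have h2 : q y ≤ m + 1 := by simp only [hq]; linarith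
      have h3 : m + 1 - k ≤ E := le_abs_self _
      rw [Metric.mem_closedBall, dist_eq_norm]
      by_contra! hcon
      obtain ⟨h4, h5⟩ := max_lt_iff.1 hcon
      rw [div_lt_iff₀ hc] at h5
      have h6 : 0 ≤ E := abs_nonneg _
      nlinarith) (by
      intro ε hε
      obtain ⟨_, ⟨y, hy, rfl⟩, hlt⟩ := exists_lt_of_csInf_lt (hf.dom_nonempty.image q)
        (lt_add_of_pos_right m hε)
      refine ⟨y, trivial, hf.le_coe_iff.2 ⟨hy, ?_⟩⟩
      simp only [hq] at hlt
      linarith)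
  obtain ⟨hzd, hz⟩ := hf.le_coe_iff.1 hz
  -- First-order optimality: compare `z` with `z + t (y - z)` and let `t` tend to `0`.
  refine ⟨z, hf.mem_subdiff_iff.2 ⟨hzd, fun y hy => ?_⟩⟩
  refine le_of_forall_pos_lt_add fun ε hε => ?_
  set B := c / 2 * ‖y - z‖ ^ 2 with hB
  have hB0 : 0 ≤ B := by positivity
  obtain ⟨t, ht0, ht1, htB⟩ : ∃ t : ℝ, 0 < t ∧ t < 1 ∧ t * B < ε := by
    refine ⟨min (1 / 2) (ε / (B + 1) / 2), by positivity,
      lt_of_le_of_lt (min_le_left _ _) (by norm_num), ?_⟩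
    calc _ ≤ ε / (B + 1) / 2 * (B + 1) := by
          gcongr
          · exact min_le_right _ _
          · linarith
      _ = ε / 2 := by field_simp
      _ < ε := by linarith
  have hs := hf.convexOn.2 hzd hy (sub_nonneg.2 ht1.le) ht0.le (sub_add_cancel 1 t)
  have hsd := hf.convexOn.1 hzd hy (sub_nonneg.2 ht1.le) ht0.le (sub_add_cancel 1 t)
  have hp : (1 - t) • z + t • y = z + t • (y - z) := by rw [smul_sub, sub_smul, one_smul]; abel
  have h1 := hmle _ hsd
  simp only [hq, smul_eq_mul] at h1 hs
  rw [hp] at h1 hs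
  have h2 : ‖z + t • (y - z) - a‖ ^ 2
      = ‖z - a‖ ^ 2 + 2 * t * inner ℝ (z - a) (y - z) + t ^ 2 * ‖y - z‖ ^ 2 := by
    rw [show z + t • (y - z) - a = (z - a) + t • (y - z) by abel, norm_add_sq_real,
      inner_smul_right, norm_smul, mul_pow, Real.norm_eq_abs, sq_abs]
    ring
  rw [h2] at h1
  have h3 : inner ℝ (c • (a - z)) (y - z) = -(c * inner ℝ (z - a) (y - z)) := by
    rw [real_inner_smul_left, ← neg_sub z a, inner_neg_left]; ring
  rw [h3]
  have h4 : 0 ≤ t * ((f y).toReal - (f z).toReal + c * inner ℝ (z - a) (y - z) + t * B) := by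
    rw [hB]; nlinarith
  have h5 := nonneg_of_mul_nonneg_right h4 ht0
  linarith

/-- The Fenchel–Moreau theorem, for functions having some subgradient. The proximal points of `x`
converge to `x` as the parameter `c` grows, and `f` is bounded by `f**(x)` there. -/
theorem IsGammaZero.conj_conj [CompleteSpace H] (hf : IsGammaZero f) {u₀ x₀ : H}
    (h₀ : u₀ ∈ subdiff f x₀) : conj (conj f) = f := by
  funext x
  apply le_antisymm
  · refine iSup_le fun u => ?_
    by_cases hx : x ∈ dom f
    · by_cases hu : u ∈ dom (conj f)
      · have := hf.inner_sub_le_conj hu hx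
        rw [real_inner_comm] at this
        rw [← hf.coe_toReal hx, ← hf.coe_toReal_conj hu, ← EReal.coe_sub, EReal.coe_le_coe_iff]
        linarith
      · have : conj f u = ⊤ := not_lt_top_iff.1 hu
        simp [this]
    · have : f x = ⊤ := not_lt_top_iff.1 hx
      simp [this]
  · by_contra! hlt
    obtain ⟨k, hk1, hk2⟩ := EReal.lt_iff_exists_real_btwn.1 hlt
    refine absurd hk2 (not_lt.2 ?_)
    have hcl : IsClosed {y | f y ≤ (k : EReal)} := hf.isClosed_le continuous_const
    refine hcl.closure_subset (Metric.mem_closure_iff.2 fun ε hε => ?_)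
    obtain ⟨-, hmin⟩ := hf.mem_subdiff_iff.1 h₀
    set C := |k - ((f x₀).toReal + inner ℝ u₀ (x - x₀))| with hC
    set c := C / ε ^ 2 + ‖u₀‖ / ε + 1 with hc
    have hc0 : 0 < c := by positivity
    obtain ⟨z, hz⟩ := hf.exists_prox h₀ hc0 x
    have hzd := (hf.mem_subdiff_iff.1 hz).1
    have h1 : ((inner ℝ x (c • (x - z)) : ℝ) : EReal) - conj f (c • (x - z)) ≤ (k : EReal) :=
      (le_iSup (fun u : H => ((inner ℝ x u : ℝ) : EReal) - conj f u) _).trans hk1.le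
    rw [hf.conj_eq_of_mem_subdiff hz] at h1
    replace h1 : inner ℝ x (c • (x - z)) - (inner ℝ (c • (x - z)) z - (f z).toReal) ≤ k := by
      exact_mod_cast h1
    have h2 : inner ℝ x (c • (x - z)) - inner ℝ (c • (x - z)) z = c * ‖x - z‖ ^ 2 := by
      rw [real_inner_comm, ← inner_sub_right, real_inner_smul_left, real_inner_self_eq_norm_sq]
    have h3 : (f z).toReal + c * ‖x - z‖ ^ 2 ≤ k := by linarith
    refine ⟨z, hf.le_coe_iff.2 ⟨hzd, ?_⟩, ?_⟩
    · have : 0 ≤ c * ‖x - z‖ ^ 2 := by positivity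
      linarith
    · rw [dist_eq_norm]
      by_contra! hd
      have h4 := hmin z hzd
      have h5 : inner ℝ u₀ (z - x₀) = inner ℝ u₀ (x - x₀) - inner ℝ u₀ (x - z) := by
        rw [← inner_sub_right]; congr 1; abel
      have h6 := real_inner_le_norm u₀ (x - z)
      have h7 := le_abs_self (k - ((f x₀).toReal + inner ℝ u₀ (x - x₀)))
      have h8 : c * ‖x - z‖ ^ 2 ≤ C + ‖u₀‖ * ‖x - z‖ := by linarith
      have hd0 : 0 < ‖x - z‖ := hε.trans_le hd
      have h9 : C ≤ C / ε ^ 2 * ‖x - z‖ ^ 2 := by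
        rw [div_mul_eq_mul_div, le_div_iff₀ (by positivity)]
        gcongr
      have h10 : ‖u₀‖ * ‖x - z‖ ≤ ‖u₀‖ / ε * ‖x - z‖ ^ 2 := by
        rw [div_mul_eq_mul_div, le_div_iff₀ hε, sq, ← mul_assoc]
        gcongr
      have h11 : c * ‖x - z‖ ^ 2
          = C / ε ^ 2 * ‖x - z‖ ^ 2 + ‖u₀‖ / ε * ‖x - z‖ ^ 2 + ‖x - z‖ ^ 2 := by rw [hc]; ring
      nlinarith [pow_pos hd0 2]

/-! ### Gâteaux gradients -/

theorem HasGateauxGradientAt.unique {u v x : H} (hu : HasGateauxGradientAt f u x)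
    (hv : HasGateauxGradientAt f v x) : u = v :=
  ext_inner_right ℝ fun h => HasDerivAt.unique (hu h) (hv h)

theorem HasGateauxGradientAt.grad_eq {u x : H} (hu : HasGateauxGradientAt f u x) :
    grad f x = u := by
  have h : ∃ u, HasGateauxGradientAt f u x := ⟨u, hu⟩
  rw [grad, dif_pos h]
  exact h.choose_spec.unique hu

/-- Points near `x ∈ int dom f` on a line through `x` stay in `int dom f`. -/
theorem eventually_add_smul_mem_intDom {x : H} (hx : x ∈ intDom f) (h : H) :
    ∀ᶠ t : ℝ in 𝓝 0, x + t • h ∈ intDom f := by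
  have hc : Tendsto (fun t : ℝ => x + t • h) (𝓝 0) (𝓝 x) := by
    have : Continuous fun t : ℝ => x + t • h := by fun_prop
    simpa using this.tendsto 0
  exact hc.eventually (isOpen_interior.mem_nhds hx)

theorem intDom_subset_dom {X : Type*} [NormedAddCommGroup X] {f : X → EReal} : intDom f ⊆ dom f := interior_subset

theorem IsGammaZero.subgradient_eq_gradient (hf : IsGammaZero f) {u w x : H} (hx : x ∈ intDom f)
    (hu : u ∈ subdiff f x) (hw : HasGateauxGradientAt f w x) : u = w := by
  refine ext_inner_right ℝ fun h => ?_
  obtain ⟨-, hu⟩ := hf.mem_subdiff_iff.1 hu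
  have hd : HasDerivAt (fun t : ℝ => (f (x + t • h)).toReal - t * inner ℝ u h)
      (inner ℝ w h - 1 * inner ℝ u h) 0 :=
    HasDerivAt.sub (hw h) ((hasDerivAt_id (0 : ℝ)).mul_const _)
  have hmin : IsLocalMin (fun t : ℝ => (f (x + t • h)).toReal - t * inner ℝ u h) 0 := by
    filter_upwards [eventually_add_smul_mem_intDom hx h] with t ht
    have := hu _ (intDom_subset_dom ht)
    rw [add_sub_cancel_left, inner_smul_right] at this
    simp only [zero_smul, add_zero, zero_mul, sub_zero]
    linarith
  have := hmin.hasDerivAt_eq_zero hd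
  linarith

/-! ### Subgradients and the interior of the domain of the conjugate -/

/-- If `(∂f)⁻¹` is locally bounded at `u ∈ ∂f(x)`, then `f - u` grows linearly, so that `u` is
interior to `dom f*`. If the growth were too slow at a far point `y`, a proximal point of `y` would
be far away as well and carry a subgradient close to `u`. -/
theorem IsGammaZero.mem_intDom_conj [CompleteSpace H] (hf : IsGammaZero f) {u x : H}
    (hu : u ∈ subdiff f x) (hb : LocallyBoundedAt (invSubdiff f) u) : u ∈ intDom (conj f) := by
  obtain ⟨δ, hδ, hbd⟩ := hb
  obtain ⟨R, hR⟩ := hbd.exists_norm_le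
  have hR' : ∀ z v, ‖v - u‖ ≤ δ → v ∈ subdiff f z → ‖z‖ ≤ R := fun z v hv hz =>
    hR z (Set.mem_biUnion (by rwa [Metric.mem_closedBall, dist_eq_norm]) hz)
  obtain ⟨hx, hmin⟩ := hf.mem_subdiff_iff.1 hu
  have hRx : ‖x‖ ≤ R := hR' x u (by simpa using hδ.le) hu
  have hR0 : 0 ≤ R := (norm_nonneg x).trans hRx
  have hgrow : ∀ y ∈ dom f,
      δ / 2 * (‖y - x‖ - 4 * R) ≤ (f y).toReal - inner ℝ u (y - x) - (f x).toReal := by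
    intro y hy
    by_contra! hcon
    have h0 := hmin y hy
    have hr : 4 * R < ‖y - x‖ := by
      by_contra! h
      nlinarith
    have hr0 : 0 < ‖y - x‖ := by linarith
    set r := ‖y - x‖ with hrdef
    set c := 2 * δ / r with hc
    have hc0 : 0 < c := by positivity
    have hcr : c * r = 2 * δ := by rw [hc]; field_simp
    -- The shift of the base point by `u / c` turns a proximal point of `f - u` into one of `f`.
    obtain ⟨z, hz⟩ := hf.exists_prox hu hc0 (y + c⁻¹ • u)
    have hv : c • (y + c⁻¹ • u - z) = u + c • (y - z) := by
      rw [add_sub_right_comm, smul_add, smul_inv_smul₀ hc0.ne', add_comm]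
    rw [hv] at hz
    obtain ⟨hzd, hz'⟩ := hf.mem_subdiff_iff.1 hz
    have h1 := hz' y hy
    rw [inner_add_left, real_inner_smul_left, real_inner_self_eq_norm_sq] at h1
    have h2 := hmin z hzd
    have h3 : inner ℝ u (y - x) = inner ℝ u (y - z) + inner ℝ u (z - x) := by
      rw [← inner_add_right]; congr 1; abel
    have h4 : c * ‖y - z‖ ^ 2 < δ / 2 * r := by nlinarith
    have h5 : ‖y - z‖ < r / 2 := by
      by_contra! h
      have : c * (r / 2) ^ 2 ≤ c * ‖y - z‖ ^ 2 := by gcongr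
      nlinarith
    have h6 : ‖z‖ ≤ R := by
      refine hR' z _ ?_ hz
      rw [add_sub_cancel_left, norm_smul, Real.norm_of_nonneg hc0.le]
      nlinarith
    have h7 : r ≤ ‖y - z‖ + ‖z - x‖ := by
      rw [hrdef]; exact norm_sub_le_norm_sub_add_norm_sub y z x
    have h8 := norm_sub_le z x
    linarith
  rw [intDom, mem_interior_iff_mem_nhds, Metric.mem_nhds_iff]
  refine ⟨δ / 2, by positivity, fun w hw => ?_⟩
  rw [Metric.mem_ball, dist_eq_norm] at hw
  refine mem_dom_of_le_coe (k := inner ℝ w x - (f x).toReal + δ / 2 * (4 * R))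
    (hf.conj_le_coe_iff.2 fun y hy => ?_)
  have h1 := hgrow y hy
  have h2 := real_inner_le_norm (w - u) (y - x)
  have h3 : ‖w - u‖ * ‖y - x‖ ≤ δ / 2 * ‖y - x‖ := by gcongr
  rw [inner_sub_left] at h2
  have h4 : inner ℝ w y = inner ℝ w x + inner ℝ w (y - x) := by rw [← inner_add_right]; simp
  linarith

/-- For `u ∈ int dom f*` the sublevel sets of `f - u` are bounded: `f*` bounds each `⟨v, ·⟩` on
them, so the Banach–Steinhaus theorem applies. -/
theorem IsGammaZero.isBounded_sublevel [CompleteSpace H] (hf : IsGammaZero f) {u : H}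
    (hu : u ∈ intDom (conj f)) (k : ℝ) :
    Bornology.IsBounded {y | f y ≤ ((inner ℝ u y + k : ℝ) : EReal)} := by
  set B := {y | f y ≤ ((inner ℝ u y + k : ℝ) : EReal)} with hB
  have hone : ∀ v : H, ∃ M : ℝ, ∀ y ∈ B, inner ℝ v y ≤ M := by
    intro v
    obtain ⟨t, ht, ht0⟩ := ((eventually_add_smul_mem_intDom hu v).filter_mono
      nhdsWithin_le_nhds |>.and (self_mem_nhdsWithin : Set.Ioi (0 : ℝ) ∈ 𝓝[>] 0)).exists
    replace ht0 : 0 < t := ht0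
    refine ⟨((conj f (u + t • v)).toReal + k) / t, fun y hy => ?_⟩
    obtain ⟨hyd, hy⟩ := hf.le_coe_iff.1 hy
    have := hf.inner_sub_le_conj (intDom_subset_dom ht) hyd
    rw [inner_add_left, real_inner_smul_left] at this
    rw [le_div_iff₀ ht0]
    linarith
  obtain ⟨M, hM⟩ := banach_steinhaus (g := fun y : B => innerSL ℝ (y : H)) (fun v => by
    obtain ⟨M₁, h₁⟩ := hone v
    obtain ⟨M₂, h₂⟩ := hone (-v)
    refine ⟨max M₁ M₂, fun y => ?_⟩
    have h1 := h₁ y y.2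
    have h2 := h₂ y y.2
    rw [inner_neg_left] at h2
    rw [innerSL_apply_apply, real_inner_comm, Real.norm_eq_abs, abs_le]
    exact ⟨by linarith [le_max_right M₁ M₂], h1.trans (le_max_left _ _)⟩)
  rw [isBounded_iff_forall_norm_le]
  exact ⟨M, fun y hy => by simpa using hM ⟨y, hy⟩⟩

/-- If `f*(u)` is approached along a closed convex set `C`, it is attained there. -/
theorem IsGammaZero.exists_mem_subdiff [CompleteSpace H] (hf : IsGammaZero f) {u : H}
    (hu : u ∈ intDom (conj f)) {C : Set H} (hC : IsClosed C) (hCc : Convex ℝ C)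
    (hne : ∀ ε : ℝ, 0 < ε → ∃ y ∈ C, y ∈ dom f ∧
      (conj f u).toReal - ε ≤ inner ℝ u y - (f y).toReal) :
    ∃ y ∈ C, u ∈ subdiff f y := by
  have hconc : ConcaveOn ℝ Set.univ fun y : H => inner ℝ u y - (conj f u).toReal := by
    have := (innerSL ℝ u).toLinearMap.concaveOn convex_univ
    exact this.sub (convexOn_const _ convex_univ)
  obtain ⟨y, hyC, hy⟩ := hf.exists_le (by fun_prop) hconc hC hCc (by
    refine (hf.isBounded_sublevel hu (1 - (conj f u).toReal)).subset fun y hy => ?_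
    obtain ⟨hyd, hy⟩ := hf.le_coe_iff.1 hy
    exact hf.le_coe_iff.2 ⟨hyd, by linarith⟩) (by
    intro ε hε
    obtain ⟨y, hyC, hyd, hy⟩ := hne ε hε
    exact ⟨y, hyC, hf.le_coe_iff.2 ⟨hyd, by linarith⟩⟩)
  exact ⟨y, hyC, hf.mem_subdiff_of_le (intDom_subset_dom hu) hy⟩

theorem IsGammaZero.exists_invSubdiff [CompleteSpace H] (hf : IsGammaZero f) {u : H}
    (hu : u ∈ intDom (conj f)) : ∃ x, u ∈ subdiff f x := by
  obtain ⟨x, -, hx⟩ := hf.exists_mem_subdiff hu isClosed_univ convex_univ (by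
    intro ε hε
    by_contra! hcon
    have h : conj f u ≤ (((conj f u).toReal - ε : ℝ) : EReal) :=
      hf.conj_le_coe_iff.2 fun y hy => (hcon y trivial hy).le
    rw [← hf.coe_toReal_conj (intDom_subset_dom hu), EReal.coe_le_coe_iff, EReal.toReal_coe] at h
    linarith)
  exact ⟨x, hx⟩

/-- If `u ∈ int dom f*` is a subgradient of `f` at the single point `x`, then `x` is the Gâteaux
gradient of `f*` at `u`. Otherwise some one-sided difference quotient of `f*` would exceed
`⟨x, h⟩ + ε`; near-maximizers in the definition of `f*` would then lie in the half-space
`⟨h, y⟩ ≥ ⟨x, h⟩ + ε`, and so would a second point having `u` as a subgradient. -/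
theorem IsGammaZero.hasGateauxGradientAt_conj [CompleteSpace H] (hf : IsGammaZero f) {u x : H}
    (hu : u ∈ intDom (conj f)) (hx : u ∈ subdiff f x) (huniq : ∀ y, u ∈ subdiff f y → y = x) :
    HasGateauxGradientAt (conj f) x u := by
  obtain ⟨hxd, -⟩ := hf.mem_subdiff_iff.1 hx
  have hux : (conj f u).toReal = inner ℝ u x - (f x).toReal := by
    rw [hf.conj_eq_of_mem_subdiff hx, EReal.toReal_coe]
  have hlow : ∀ h, ∀ t : ℝ, u + t • h ∈ intDom (conj f) →
      (conj f u).toReal + t * inner ℝ x h ≤ (conj f (u + t • h)).toReal := by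
    intro h t ht
    have := hf.inner_sub_le_conj (intDom_subset_dom ht) hxd
    rw [inner_add_left, real_inner_smul_left, real_inner_comm] at this
    rw [real_inner_comm] at hux
    rw [real_inner_comm h x]
    linarith
  have hupp : ∀ h, ∀ ε : ℝ, 0 < ε → ∀ᶠ t : ℝ in 𝓝[>] 0,
      (conj f (u + t • h)).toReal ≤ (conj f u).toReal + t * (inner ℝ x h + ε) := by
    intro h ε hε
    by_contra hcon
    rw [not_eventually] at hcon
    have hev := eventually_add_smul_mem_intDom hu h
    obtain ⟨s, hs, hs0⟩ := ((hev.filter_mono nhdsWithin_le_nhds).and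
      (self_mem_nhdsWithin : Set.Ioi (0 : ℝ) ∈ 𝓝[>] 0)).exists
    replace hs0 : 0 < s := hs0
    set a := inner ℝ x h + ε with ha
    set A := (conj f (u + s • h)).toReal - (conj f u).toReal with hA
    set K := 2 * (|A| + s * |a|) / s with hK
    obtain ⟨y, hyC, hy⟩ := hf.exists_mem_subdiff hu (C := {y | a ≤ inner ℝ h y})
      (_root_.isClosed_le continuous_const (by fun_prop))
      (by
        have := (innerSL ℝ h).toLinearMap.concaveOn convex_univ |>.convex_ge a
        simpa using this) (by
      intro η hη
      have hsmall : ∀ᶠ t : ℝ in 𝓝[>] 0, t < min (s / 2) (η / (K + |a| + 1)) :=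
        (eventually_lt_nhds (by positivity)).filter_mono nhdsWithin_le_nhds
      obtain ⟨t, hbad, ⟨htm, htU⟩, ht0⟩ := (hcon.and_eventually ((hsmall.and
        (hev.filter_mono nhdsWithin_le_nhds)).and self_mem_nhdsWithin)).exists
      replace ht0 : 0 < t := ht0
      rw [not_le] at hbad
      obtain ⟨hts, htη⟩ := lt_min_iff.1 htm
      obtain ⟨y, hyd, hy⟩ : ∃ y ∈ dom f, (conj f u).toReal + t * a
          < inner ℝ (u + t • h) y - (f y).toReal := by
        by_contra! hle
        have h1 := hf.conj_le_coe_iff.2 hle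
        rw [← hf.coe_toReal_conj (intDom_subset_dom htU), EReal.coe_le_coe_iff] at h1
        linarith
      rw [inner_add_left, real_inner_smul_left] at hy
      have h1 := hf.inner_sub_le_conj (intDom_subset_dom hu) hyd
      have h2 := hf.inner_sub_le_conj (intDom_subset_dom hs) hyd
      rw [inner_add_left, real_inner_smul_left] at h2
      have h3 : a ≤ inner ℝ h y := by
        by_contra! h
        nlinarith
      refine ⟨y, h3, hyd, ?_⟩
      -- Finiteness of `f*` at `u + s h` bounds `⟨h, y⟩` by `K`, uniformly in `t`.
      have h4 : (s - t) * inner ℝ h y ≤ |A| + s * |a| := by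
        have h5 : -(t * a) ≤ s * |a| := by
          have := neg_abs_le a
          have := abs_nonneg a
          nlinarith
        have := le_abs_self A
        linarith
      have h5 : inner ℝ h y ≤ K := by
        rw [hK, le_div_iff₀ hs0]
        by_cases hp : 0 ≤ inner ℝ h y
        · nlinarith
        · have : 0 ≤ |A| + s * |a| := by positivity
          nlinarith
      have hK0 : 0 ≤ K := by positivity
      have h6 : t * (K + |a| + 1) < η := by
        rwa [lt_div_iff₀ (by positivity)] at htη
      have h7 : t * inner ℝ h y ≤ t * K := by gcongr
      have h8 : -(t * a) ≤ t * |a| := by nlinarith [neg_abs_le a]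
      nlinarith)
    rw [huniq y hy, Set.mem_ofPred_eq, real_inner_comm] at hyC
    linarith
  intro h
  have habs : ∀ h, ∀ ε : ℝ, 0 < ε → ∀ᶠ t : ℝ in 𝓝[>] 0,
      |(conj f (u + t • h)).toReal - (conj f u).toReal - t * inner ℝ x h| ≤ ε * |t| := by
    intro h ε hε
    filter_upwards [hupp h ε hε, (eventually_add_smul_mem_intDom hu h).filter_mono
      nhdsWithin_le_nhds, self_mem_nhdsWithin] with t h1 h2 h3
    have h4 := hlow h t h2
    rw [abs_of_pos (show 0 < t from h3), abs_le]
    constructor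
    · have : 0 < t := h3
      nlinarith
    · linarith
  rw [HasLineDerivAt, hasDerivAt_iff_isLittleO, Asymptotics.isLittleO_iff]
  intro ε hε
  have hboth : ∀ᶠ t : ℝ in 𝓝[>] 0,
      |(conj f (u + t • h)).toReal - (conj f u).toReal - t * inner ℝ x h| ≤ ε * |t| ∧
      |(conj f (u + (-t) • h)).toReal - (conj f u).toReal - (-t) * inner ℝ x h| ≤ ε * |t| := by
    filter_upwards [habs h ε hε, habs (-h) ε hε] with t h1 h2
    refine ⟨h1, ?_⟩
    simpa using h2
  obtain ⟨τ, hτ, hτ'⟩ := (mem_nhdsGT_iff_exists_Ioo_subset).1 hboth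
  filter_upwards [Metric.ball_mem_nhds (0 : ℝ) hτ] with t ht
  rw [Metric.mem_ball, Real.dist_eq, sub_zero, abs_lt] at ht
  simp only [zero_smul, add_zero, sub_zero, smul_eq_mul, Real.norm_eq_abs]
  rcases lt_trichotomy t 0 with h0 | h0 | h0
  · have := (hτ' (show -t ∈ Set.Ioo 0 τ from ⟨by linarith, by linarith⟩)).2
    simpa using this
  · simp [h0]
  · exact (hτ' ⟨h0, ht.2⟩).1

/-! ### The gradient of a Legendre function -/

theorem IsLegendre.hasGateauxGradientAt_grad (hf : IsLegendre f) {x : H} (hx : x ∈ intDom f) :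
    HasGateauxGradientAt f (grad f x) x := by
  obtain ⟨w, hw⟩ := hf.smooth.differentiable x hx
  rwa [hw.grad_eq]

theorem IsLegendre.mem_intDom_of_mem_subdiff (hf : IsLegendre f) {u x : H}
    (hu : u ∈ subdiff f x) : x ∈ intDom f :=
  hf.smooth.domSubdiff_eq ▸ (⟨u, hu⟩ : x ∈ domSubdiff f)

theorem IsLegendre.mem_subdiff_iff_grad (hf : IsLegendre f) {u x : H} :
    u ∈ subdiff f x ↔ x ∈ intDom f ∧ grad f x = u := by
  constructor
  · intro hu
    have hx := hf.mem_intDom_of_mem_subdiff hu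
    exact ⟨hx, (hf.gammaZero.subgradient_eq_gradient hx hu (hf.hasGateauxGradientAt_grad hx)).symm⟩
  · rintro ⟨hx, rfl⟩
    obtain ⟨u, hu⟩ : x ∈ domSubdiff f := hf.smooth.domSubdiff_eq ▸ hx
    rwa [← hf.gammaZero.subgradient_eq_gradient hx hu (hf.hasGateauxGradientAt_grad hx)]

/-- Essential strict convexity makes `(∂f)⁻¹` single-valued: the points having `u` as a subgradient
form a convex set on which `f` is affine. -/
theorem IsLegendre.subdiff_injective (hf : IsLegendre f) {u x y : H} (hx : u ∈ subdiff f x)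
    (hy : u ∈ subdiff f y) : x = y := by
  by_contra hne
  have hΓ := hf.gammaZero
  obtain ⟨hxd, hx'⟩ := hΓ.mem_subdiff_iff.1 hx
  obtain ⟨hyd, hy'⟩ := hΓ.mem_subdiff_iff.1 hy
  have hxy := hx' y hyd
  have hyx := hy' x hxd
  rw [inner_sub_right] at hxy hyx
  have hconv : Convex ℝ (invSubdiff f u) := by
    rw [convex_iff_forall_pos]
    intro p hp q hq a b ha hb hab
    obtain ⟨hpd, hp⟩ := hΓ.mem_subdiff_iff.1 hp
    obtain ⟨hqd, hq⟩ := hΓ.mem_subdiff_iff.1 hq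
    refine hΓ.mem_subdiff_iff.2 ⟨hΓ.convexOn.1 hpd hqd ha.le hb.le hab, fun w hw => ?_⟩
    have h1 := hΓ.convexOn.2 hpd hqd ha.le hb.le hab
    have h2 := hp w hw
    have h3 := hq w hw
    simp only [smul_eq_mul] at h1
    simp only [inner_sub_right, inner_add_right, inner_smul_right] at h2 h3 ⊢
    have h4 := mul_le_mul_of_nonneg_left h2 ha.le
    have h5 := mul_le_mul_of_nonneg_left h3 hb.le
    obtain rfl : b = 1 - a := by linarith
    linarith
  have hlt := hf.strictlyConvex.strictConvex (invSubdiff f u) (fun z hz => ⟨u, hz⟩) hconv x hx y hy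
    hne (1 / 2) (1 / 2) (by norm_num) (by norm_num) (by norm_num)
  have hm : (1 / 2 : ℝ) • x + (1 / 2 : ℝ) • y ∈ dom f :=
    hΓ.convexOn.1 hxd hyd (by norm_num) (by norm_num) (by norm_num)
  rw [← hΓ.coe_toReal hxd, ← hΓ.coe_toReal hyd, ← hΓ.coe_toReal hm, ← EReal.coe_mul,
    ← EReal.coe_mul, ← EReal.coe_add, EReal.coe_lt_coe_iff] at hlt
  have h := hx' _ hm
  simp only [inner_sub_right, inner_add_right, inner_smul_right] at h
  linarith

/-- `∇f` maps `int dom f` into `int dom f*`, and `∇f*` inverts it from the left. -/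
theorem IsLegendre.grad_mem_and_grad_conj_grad [CompleteSpace H] (hf : IsLegendre f) {x : H}
    (hx : x ∈ intDom f) : grad f x ∈ intDom (conj f) ∧ grad (conj f) (grad f x) = x := by
  have hs := hf.mem_subdiff_iff_grad.2 ⟨hx, rfl⟩
  have hu := hf.gammaZero.mem_intDom_conj hs (hf.strictlyConvex.locallyBounded _ ⟨x, hs⟩)
  exact ⟨hu, (hf.gammaZero.hasGateauxGradientAt_conj hu hs
    fun _ hy => hf.subdiff_injective hy hs).grad_eq⟩

/-- `∇f*` maps `int dom f*` into `int dom f`, and `∇f` inverts it from the left. -/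
theorem IsLegendre.grad_conj_mem_and_grad_grad_conj [CompleteSpace H] (hf : IsLegendre f) {u : H}
    (hu : u ∈ intDom (conj f)) : grad (conj f) u ∈ intDom f ∧ grad f (grad (conj f) u) = u := by
  obtain ⟨x, hx⟩ := hf.gammaZero.exists_invSubdiff hu
  obtain ⟨hxU, rfl⟩ := hf.mem_subdiff_iff_grad.1 hx
  rw [(hf.grad_mem_and_grad_conj_grad hxU).2]
  exact ⟨hxU, rfl⟩

theorem IsLegendre.conj_conj [CompleteSpace H] (hf : IsLegendre f) : conj (conj f) = f := by
  obtain ⟨x, hx⟩ := hf.smooth.intDom_nonempty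
  exact hf.gammaZero.conj_conj (hf.mem_subdiff_iff_grad.2 ⟨hx, rfl⟩)

/-- Passing to the conjugate and to gradients swaps the arguments of the Bregman distance. -/
theorem IsLegendre.bregmanDist_eq [CompleteSpace H] (hf : IsLegendre f) {x y : H}
    (hx : x ∈ intDom f) (hy : y ∈ intDom f) :
    bregmanDist f x y = bregmanDist (conj f) (grad f y) (grad f x) := by
  have hΓ := hf.gammaZero
  obtain ⟨hu, hgu⟩ := hf.grad_mem_and_grad_conj_grad hx
  rw [bregmanDist, bregmanDist, if_pos hy, if_pos hu, hgu,
    hΓ.conj_eq_of_mem_subdiff (hf.mem_subdiff_iff_grad.2 ⟨hx, rfl⟩),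
    hΓ.conj_eq_of_mem_subdiff (hf.mem_subdiff_iff_grad.2 ⟨hy, rfl⟩),
    ← hΓ.coe_toReal (intDom_subset_dom hx), ← hΓ.coe_toReal (intDom_subset_dom hy)]
  norm_cast
  simp only [EReal.toReal_coe, inner_sub_right]
  rw [real_inner_comm (grad f y) x, real_inner_comm (grad f x) x]
  ring

/-! ### Equidistant sets under the gradient -/

/-- A set is the image under `∇f*` of `T` as soon as it consists of the points of `int dom f` whose
gradient lies in `T`. -/
theorem IsLegendre.eq_gradImage_conj [CompleteSpace H] (hf : IsLegendre f) {A T : Set H}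
    (hA : A ⊆ intDom f) (h : ∀ p ∈ intDom f, p ∈ A ↔ grad f p ∈ T) :
    A = gradImage (conj f) T := by
  ext p
  constructor
  · intro hp
    obtain ⟨hu, hgu⟩ := hf.grad_mem_and_grad_conj_grad (hA hp)
    exact ⟨grad f p, ⟨(h p (hA hp)).1 hp, hu⟩, hgu⟩
  · rintro ⟨u, ⟨huT, hu⟩, rfl⟩
    obtain ⟨hp, hgp⟩ := hf.grad_conj_mem_and_grad_grad_conj hu
    exact (h _ hp).2 (hgp.symm ▸ huT)

theorem IsLegendre.grad_mem_gradImage_iff [CompleteSpace H] (hf : IsLegendre f) {p : H} {A : Set H}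
    (hp : p ∈ intDom f) : grad f p ∈ gradImage f A ↔ p ∈ A := by
  constructor
  · rintro ⟨q, ⟨hqA, hq⟩, hqp⟩
    rw [← (hf.grad_mem_and_grad_conj_grad hp).2, ← hqp, (hf.grad_mem_and_grad_conj_grad hq).2]
    exact hqA
  · exact fun h => ⟨p, ⟨h, hp⟩, rfl⟩

theorem gradImage_eq_image {S : Set H} (hS : S ⊆ intDom f) : gradImage f S = grad f '' S := by
  rw [gradImage, Set.inter_eq_left.2 hS]

theorem IsLegendre.mem_backwardE_iff [CompleteSpace H] (hf : IsLegendre f) {S : Set H}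
    (hS : S ⊆ intDom f) {p : H} (hp : p ∈ intDom f) :
    p ∈ backwardE f S ↔ grad f p ∈ forwardE (conj f) (gradImage f S) := by
  have hu := (hf.grad_mem_and_grad_conj_grad hp).1
  simp only [backwardE, forwardE, Set.mem_ofPred_eq, gradImage_eq_image hS, Set.forall_mem_image, hu,
    intDom_subset_dom hp, true_and]
  refine forall₂_congr fun q hq => forall₂_congr fun r hr => ?_
  rw [hf.bregmanDist_eq hp (hS hq), hf.bregmanDist_eq hp (hS hr)]

theorem IsLegendre.mem_forwardE_iff [CompleteSpace H] (hf : IsLegendre f) {S : Set H}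
    (hS : S ⊆ intDom f) {p : H} (hp : p ∈ intDom f) :
    p ∈ forwardE f S ↔ grad f p ∈ backwardE (conj f) (gradImage f S) := by
  have hu := (hf.grad_mem_and_grad_conj_grad hp).1
  simp only [backwardE, forwardE, Set.mem_ofPred_eq, gradImage_eq_image hS, Set.forall_mem_image, hp,
    intDom_subset_dom hu, true_and]
  refine forall₂_congr fun q hq => forall₂_congr fun r hr => ?_
  rw [hf.bregmanDist_eq (hS hq) hp, hf.bregmanDist_eq (hS hr) hp]

theorem IsLegendre.forwardE_eq [CompleteSpace H] (hf : IsLegendre f) {S : Set H}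
    (hS : S ⊆ intDom f) : forwardE f S =
      gradImage (conj f) (backwardE (conj f) (gradImage f S) ∩ intDom (conj f)) :=
  hf.eq_gradImage_conj (fun _ hp => hp.1) fun p hp => by
    rw [hf.mem_forwardE_iff hS hp, Set.mem_inter_iff,
      and_iff_left (hf.grad_mem_and_grad_conj_grad hp).1]

end Bregman

theorem theorem5p1 {H : Type*} [NormedAddCommGroup H] [InnerProductSpace ℝ H] [CompleteSpace H]
    (f : H → EReal) (hf : Bregman.IsLegendre f)
    (S : Set H) (hSfin : S.Finite) (hSne : S.Nonempty) (hS : S ⊆ Bregman.intDom f) :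
    (Bregman.backwardE f S ∩ Bregman.intDom f =
      Bregman.gradImage (Bregman.conj f)
        (Bregman.forwardE (Bregman.conj f) (Bregman.gradImage f S))) ∧
    (Bregman.forwardE f S =
      Bregman.gradImage (Bregman.conj f)
        (Bregman.backwardE (Bregman.conj f) (Bregman.gradImage f S) ∩
          Bregman.intDom (Bregman.conj f))) ∧
    (Bregman.backwardPseudoCC f S ∩ Bregman.intDom f =
      Bregman.gradImage (Bregman.conj f)
        (Bregman.forwardPseudoCC (Bregman.conj f) (Bregman.gradImage f S))) ∧
    (Bregman.forwardCC f S =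
      (affineSpan ℝ S : Set H) ∩
        Bregman.gradImage (Bregman.conj f)
          (Bregman.backwardE (Bregman.conj f) (Bregman.gradImage f S) ∩
            Bregman.intDom (Bregman.conj f))) ∧
    (Bregman.forwardCC f S =
      Bregman.gradImage (Bregman.conj f)
        (Bregman.gradImage f (affineSpan ℝ S : Set H) ∩
          Bregman.backwardE (Bregman.conj f) (Bregman.gradImage f S))) := by
  refine ⟨?_, hf.forwardE_eq hS, ?_, ?_, ?_⟩
  · refine hf.eq_gradImage_conj Set.inter_subset_right fun p hp => ?_
    rw [Set.mem_inter_iff, and_iff_left hp, hf.mem_backwardE_iff hS hp]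
  · refine hf.eq_gradImage_conj Set.inter_subset_right fun p hp => ?_
    rw [Bregman.forwardPseudoCC, hf.conj_conj, Bregman.backwardPseudoCC, Set.mem_inter_iff,
      and_iff_left hp, Set.mem_inter_iff, Set.mem_inter_iff, hf.mem_backwardE_iff hS hp,
      hf.grad_mem_gradImage_iff hp]
  · rw [Bregman.forwardCC, hf.forwardE_eq hS]
  · refine hf.eq_gradImage_conj (fun p hp => hp.2.1) fun p hp => ?_
    rw [Bregman.forwardCC, Set.mem_inter_iff, Set.mem_inter_iff, hf.mem_forwardE_iff hS hp,
      hf.grad_mem_gradImage_iff hp]
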